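/- Fix $\eta>50$. For $n\in\mathbb N$ sufficiently large put $p=\frac{\eta\log n}{n-1}\in[0,1]$, and let $(G_t)_{t\in\mathbb Z}$ be independent Erdős–Rényi random graphs on the vertex set $[n]=\{1,\dots,n\}$ with edge probability $p$, with joint law $\mathbf P$. Let $P_t$ be the transition matrix of the lazy simple random walk on $G_t$: $P_t(x,x)=\tfrac12$ if $\deg_t(x)\ge 1$, $P_t(x,x)=1$ if $\deg_t(x)=0$, $P_t(x,y)=\frac{1}{2\deg_t(x)}$ if $x\ne y$ are adjacent in $G_t$, and $P_t(x,y)=0$ otherwise. For $s<t$ write $P^{s,t}=P_{s+1}P_{s+2}\cdots P_t$. The target distribution $\pi_t$ is defined by $\pi_t(y)=\lim_{s\to-\infty}P^{s,t}(x,y)$, provided that this limit exists for all $x,y\in[n]$ and does not depend on $x$. There exist constants $\alpha_1^*=\alpha_1^*(\eta)\in(0,1)$, $\alpha_2^*=\alpha_2^*(\eta)>1$ and $\beta>0$, independent of $n$, such that for all sufficiently large $n$, $\mathbf P$-almost surely $\pi_t$ exists for every $t\in\mathbb Z$, and there exist a non-decreasing real sequence $(\alpha_1^{(t)})_{0\le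 t\le n^2}$ and a non-increasing real sequence $(\alpha_2^{(t)})_{0\le t\le n^2}$ (deterministic, depending only on $n$ and $\eta$) with $\alpha_1^{(t)}=\alpha_1^*$ and $\alpha_2^{(t)}=\alpha_2^*$ for all $n^2-n\le t\le n^2$, such that $$\mathbf P\Big(\frac{\alpha_1^{(t)}}{n}\le \pi_t(x)\le\frac{\alpha_2^{(t)}}{n}\ \text{ for all } t\in\{0,\dots,n^2\},\ x\in[n]\Big)\ \ge\ 1-n^{-\beta}.$$ Moreover, with the same constants, for all sufficiently large $n$, $$\mathbf P\Big(\frac{\alpha_1^{*}}{n}\le \pi_t(x)\le\frac{\alpha_2^{*}}{n}\ \text{ for all } t\in\{0,\dots,n\},\ x\in[n]\Big)\ \ge\ 1-n^{-\beta}.$$ -/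

import Mathlib

noncomputable section

namespace DynER

/-- The matrix product `P_{s+1} P_{s+2} ⋯ P_{s+k}`. -/
def stepProd {n : ℕ} (P : ℤ → Matrix (Fin n) (Fin n) ℝ) (s : ℤ) : ℕ → Matrix (Fin n) (Fin n) ℝ
  | 0 => 1
  | k + 1 => stepProd P s k * P (s + k + 1)

/-- `P^{s,t} = P_{s+1} ⋯ P_t` for `s ≤ t` (only times `s ≤ t` are relevant below). -/
def transMat {n : ℕ} (P : ℤ → Matrix (Fin n) (Fin n) ℝ) (s t : ℤ) : Matrix (Fin n) (Fin n) ℝ :=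
  stepProd P s (t - s).toNat

/-- `π` is the target distribution at time `t`: for every starting state `x`, the row
`P^{s,t}(x, ·)` converges to `π` as `s → -∞` (the limit does not depend on `x`). -/
def IsTarget {n : ℕ} (P : ℤ → Matrix (Fin n) (Fin n) ℝ) (t : ℤ) (π : Fin n → ℝ) : Prop :=
  ∀ x y : Fin n, Filter.Tendsto (fun s : ℤ => transMat P s t x y) Filter.atBot (nhds (π y))

/-- The target distribution `π_t` exists. -/
def TargetExists {n : ℕ} (P : ℤ → Matrix (Fin n) (Fin n) ℝ) (t : ℤ) : Prop :=
  ∃ π : Fin n → ℝ, IsTarget P t π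

open Classical in
/-- The target distribution `π_t` (with value `0` where it does not exist). -/
def target {n : ℕ} (P : ℤ → Matrix (Fin n) (Fin n) ℝ) (t : ℤ) : Fin n → ℝ :=
  if h : TargetExists P t then h.choose else 0

open Classical in
/-- Transition matrix of the lazy simple random walk on a graph; isolated vertices are
absorbing. -/
def lazyWalk {n : ℕ} (G : SimpleGraph (Fin n)) : Matrix (Fin n) (Fin n) ℝ :=
  Matrix.of fun x y =>
    if x = y then (if 1 ≤ G.degree x then 1 / 2 else 1)
    else if G.Adj x y then 1 / (2 * (G.degree x : ℝ)) else 0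

/-- `(G_t)_{t ∈ ℤ}` is a sequence of independent Erdős–Rényi random graphs on `n` vertices with
edge probability `p`, defined on the probability space `(Ω, μ)`. -/
structure IsDynamicErdosRenyi {Ω : Type*} [MeasurableSpace Ω] (μ : MeasureTheory.Measure Ω)
    {n : ℕ} (p : unitInterval) (G : ℤ → Ω → SimpleGraph (Fin n)) : Prop where
  measurable : ∀ t, Measurable (G t)
  hasLaw : ∀ t, ProbabilityTheory.HasLaw (G t) (SimpleGraph.binomialRandom (Fin n) p) μ
  indep : ProbabilityTheory.iIndepFun G μ

/-- The random transition matrices of the lazy walk on the dynamic graph, at the outcome `ω`. -/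
def walkSeq {Ω : Type*} {n : ℕ} (G : ℤ → Ω → SimpleGraph (Fin n)) (ω : Ω) :
    ℤ → Matrix (Fin n) (Fin n) ℝ :=
  fun t => lazyWalk (G t ω)

end DynER

end

/-!
The walk is started at time `-(n + 1)` from an arbitrary vertex `x₀`, and its law, the row
`w = P^{s,t}(x₀, ·)`, is followed through the window `{0, …, n ^ 2}`. The target distribution is a
mixture of these rows (`target_mem_Icc`), so bounds on all rows are bounds on `π_t`; no property of
the limit is needed besides its existence.

The graph `G_{t+1}` is independent of the row `w` at time `t`. Conditionally on `w`, the mass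
`∑_{x ∼ y} w x` next to a vertex `y` is a weighted sum of independent Bernoulli variables, and
Chernoff's bound with exponent `± 1` puts it, outside an event of probability `n ^ (-5)`, between
`(1 - 1 / e) p (1 - w y) - 5 (max w) log n` and `(e - 1) p + 5 (max w) log n`. The same bound with
weights `1` controls the degrees. Graphs with these properties are called `Typical` for `w`, and
`measureReal_not_typical_le` bounds the probability of the others. A union bound over the vertices,
the starting points and the `O(n ^ 2)` times loses only a factor of order `n ^ 4`.

Along typical graphs the argument is deterministic. As `η > 50`, all degrees lie between
`η log n / 2` and `2 η log n`, and one step of the walk maps an upper bound `M` for the row to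
`(3 / 5) M + 7 / (4 n)` (`Typical.vecMul_lazyWalk_le`). After `n` steps the row is therefore at most
`5 / n`. Then the mean of the mass next to a vertex exceeds its fluctuation, and the next step puts
mass at least `1 / (40 n)` on every vertex (`Typical.le_vecMul_lazyWalk`). The constants `1 / 40`
and `5` serve the whole window, so the two deterministic sequences are constant.

Almost surely, infinitely many of the graphs in the past are complete, and the transition matrix of
a complete graph contracts oscillations by a factor depending only on `n`. This gives the existence
of the target distribution (`targetExists_of_frequently`).
-/

namespace DynER

open MeasureTheory ProbabilityTheory Filter Matrix

/-! ### Row-stochastic matrices and their products -/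

open Classical in
/-- The `w`-weight of the neighbourhood of the vertex `y`. -/
noncomputable def nbrSum {n : ℕ} (G : SimpleGraph (Fin n)) (w : Fin n → ℝ) (y : Fin n) : ℝ :=
  ∑ x, if G.Adj x y then w x else 0

open Classical in
lemma nbrSum_one {n : ℕ} (G : SimpleGraph (Fin n)) (y : Fin n) :
    nbrSum G 1 y = (G.degree y : ℝ) := by
  simp [nbrSum, ← SimpleGraph.card_neighborFinset_eq_degree, SimpleGraph.neighborFinset_eq_filter,
    SimpleGraph.adj_comm]

lemma lazyWalk_apply_self {n : ℕ} {G : SimpleGraph (Fin n)} {x : Fin n} (h : 0 < nbrSum G 1 x) :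
    lazyWalk G x x = 1 / 2 := by
  classical
  have : 1 ≤ G.degree x := by
    rw [nbrSum_one] at h
    exact_mod_cast h
  simp only [lazyWalk, Matrix.of_apply, if_true]
  rw [if_pos (by convert this)]

lemma lazyWalk_apply_of_ne {n : ℕ} (G : SimpleGraph (Fin n)) {x y : Fin n} (h : x ≠ y)
    [Decidable (G.Adj x y)] :
    lazyWalk G x y = if G.Adj x y then 1 / (2 * nbrSum G 1 x) else 0 := by
  simp only [lazyWalk, Matrix.of_apply, if_neg h, nbrSum_one]
  congr

lemma lazyWalk_mem_rowStochastic {n : ℕ} (G : SimpleGraph (Fin n)) :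
    lazyWalk G ∈ rowStochastic ℝ (Fin n) := by
  classical
  rw [mem_rowStochastic_iff_sum]
  refine ⟨fun x y => ?_, fun x => ?_⟩
  · simp only [lazyWalk, Matrix.of_apply]
    split_ifs <;> positivity
  · have hoff : ∑ y ∈ Finset.univ.erase x, lazyWalk G x y
        = nbrSum G 1 x * (1 / (2 * nbrSum G 1 x)) := by
      have hd : nbrSum G 1 x = ∑ y ∈ Finset.univ.erase x, if G.Adj y x then (1 : ℝ) else 0 := by
        rw [nbrSum, ← Finset.add_sum_erase _ _ (Finset.mem_univ x)]
        simp
      have h : ∀ y ∈ Finset.univ.erase x, lazyWalk G x y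
          = (if G.Adj y x then (1 : ℝ) else 0) * (1 / (2 * nbrSum G 1 x)) := by
        intro y hy
        rw [lazyWalk_apply_of_ne G (Finset.ne_of_mem_erase hy).symm, G.adj_comm]
        split_ifs <;> ring
      rw [Finset.sum_congr rfl h, ← Finset.sum_mul, ← hd]
    rw [← Finset.add_sum_erase _ _ (Finset.mem_univ x), hoff]
    by_cases h : 1 ≤ G.degree x
    · have h' : 0 < nbrSum G 1 x := by
        rw [nbrSum_one]
        exact_mod_cast h
      rw [lazyWalk_apply_self h']
      field_simp
      norm_num
    · have h' : nbrSum G 1 x = 0 := by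
        rw [nbrSum_one]
        exact_mod_cast (by omega : G.degree x = 0)
      have h1 : lazyWalk G x x = 1 := by
        simp only [lazyWalk, Matrix.of_apply, if_true]
        rw [if_neg (by convert h)]
      rw [h1, h']
      simp

lemma stepProd_mem_rowStochastic {n : ℕ} {P : ℤ → Matrix (Fin n) (Fin n) ℝ}
    (hP : ∀ t, P t ∈ rowStochastic ℝ (Fin n)) (s : ℤ) (k : ℕ) :
    stepProd P s k ∈ rowStochastic ℝ (Fin n) := by
  induction k with
  | zero => exact one_mem _
  | succ k ih => exact mul_mem ih (hP _)

lemma stepProd_add {n : ℕ} (P : ℤ → Matrix (Fin n) (Fin n) ℝ) (s : ℤ) (j k : ℕ) :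
    stepProd P s (j + k) = stepProd P s j * stepProd P (s + j) k := by
  induction k with
  | zero => simp [stepProd]
  | succ k ih =>
    rw [← add_assoc, stepProd, ih, stepProd, mul_assoc]
    push_cast
    simp only [add_assoc]

lemma stepProd_congr {n : ℕ} {P Q : ℤ → Matrix (Fin n) (Fin n) ℝ} {s : ℤ} {k : ℕ}
    (h : ∀ t ∈ Finset.Ioc s (s + k), P t = Q t) : stepProd P s k = stepProd Q s k := by
  induction k with
  | zero => rfl
  | succ k ih =>
    rw [stepProd, stepProd, ih, h]
    · simp only [Finset.mem_Ioc]
      push_cast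
      omega
    · intro t ht
      apply h
      simp only [Finset.mem_Ioc] at ht ⊢
      push_cast
      omega

lemma transMat_mul {n : ℕ} (P : ℤ → Matrix (Fin n) (Fin n) ℝ) {r s t : ℤ} (hrs : r ≤ s)
    (hst : s ≤ t) : transMat P r t = transMat P r s * transMat P s t := by
  simp only [transMat]
  obtain ⟨j, rfl⟩ := Int.le.dest hrs
  obtain ⟨k, rfl⟩ := Int.le.dest hst
  have h1 : (r + j + k - r).toNat = j + k := by omega
  have h2 : (r + j - r).toNat = j := by omega
  have h3 : (r + j + k - (r + j)).toNat = k := by omega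
  rw [h1, h2, h3, stepProd_add]

/-- Averaging with respect to a stochastic matrix keeps a function inside any interval. -/
lemma mulVec_mem_Icc {n : ℕ} {A : Matrix (Fin n) (Fin n) ℝ} (hA : A ∈ rowStochastic ℝ (Fin n))
    {f : Fin n → ℝ} {a b : ℝ} (hf : ∀ x, f x ∈ Set.Icc a b) (x : Fin n) :
    ∑ z, A x z * f z ∈ Set.Icc a b := by
  have hs := sum_row_of_mem_rowStochastic hA x
  constructor
  · calc a = ∑ z, A x z * a := by rw [← Finset.sum_mul, hs, one_mul]
      _ ≤ _ := Finset.sum_le_sum fun z _ =>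
        mul_le_mul_of_nonneg_left (hf z).1 (nonneg_of_mem_rowStochastic hA)
  · calc _ ≤ ∑ z, A x z * b := Finset.sum_le_sum fun z _ =>
        mul_le_mul_of_nonneg_left (hf z).2 (nonneg_of_mem_rowStochastic hA)
      _ = b := by rw [← Finset.sum_mul, hs, one_mul]

/-- Doeblin's contraction: a stochastic matrix with all entries at least `δ` shrinks the
oscillation of a function by the factor `1 - δ`. -/
lemma exists_mulVec_mem_Icc {n : ℕ} {A : Matrix (Fin n) (Fin n) ℝ}
    (hA : A ∈ rowStochastic ℝ (Fin n)) {δ : ℝ} (hδ : ∀ x y, δ ≤ A x y)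
    {f : Fin n → ℝ} {a r : ℝ} (hf : ∀ x, f x ∈ Set.Icc a (a + r)) (x₀ : Fin n) :
    ∃ a', ∀ x, ∑ z, A x z * f z ∈ Set.Icc a' (a' + (1 - δ) * r) := by
  refine ⟨δ * f x₀ + (1 - δ) * a, fun x => ?_⟩
  -- Every row is `δ` times the point mass at `x₀` plus a nonnegative remainder of mass `1 - δ`.
  set B : Fin n → ℝ := fun z => A x z - if z = x₀ then δ else 0 with hB
  have hB0 : ∀ z, 0 ≤ B z := by
    intro z
    simp only [hB]
    split_ifs with h
    · linarith [hδ x z]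
    · simpa using nonneg_of_mem_rowStochastic hA
  have hBs : ∑ z, B z = 1 - δ := by
    simp [hB, Finset.sum_sub_distrib, sum_row_of_mem_rowStochastic hA x]
  have hsum : ∑ z, A x z * f z = δ * f x₀ + ∑ z, B z * f z := by
    simp [hB, sub_mul, Finset.sum_sub_distrib, ite_mul]
  rw [hsum, ← hBs, Finset.sum_mul, Finset.sum_mul]
  constructor
  · gcongr with z
    · exact hB0 z
    · exact (hf z).1
  · rw [add_assoc, ← Finset.sum_add_distrib]
    gcongr with z
    rw [← mul_add]
    exact mul_le_mul_of_nonneg_left (hf z).2 (hB0 z)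

/-! ### Existence of the target distribution -/

/-- If infinitely many transition matrices in the past have all entries at least `δ > 0`, then the
oscillation of every column of `P^{s,t}` tends to `0`, and the target distribution exists. -/
lemma targetExists_of_frequently {n : ℕ} {P : ℤ → Matrix (Fin n) (Fin n) ℝ}
    (hP : ∀ t, P t ∈ rowStochastic ℝ (Fin n)) {δ : ℝ} (hδ0 : 0 < δ)
    (hfreq : ∀ t : ℤ, ∃ s ≤ t, ∀ x y, δ ≤ P s x y) (t : ℤ) : TargetExists P t := by
  rcases isEmpty_or_nonempty (Fin n) with hn | ⟨⟨x₀⟩⟩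
  · exact ⟨0, fun x => (hn.false x).elim⟩
  have hT : ∀ s t, transMat P s t ∈ rowStochastic ℝ (Fin n) := fun s t =>
    stepProd_mem_rowStochastic hP _ _
  have hpast : ∀ {r s : ℤ} (_ : r ≤ s) (_ : s ≤ t) (x y : Fin n),
      transMat P r t x y = ∑ z, transMat P r s x z * transMat P s t z y := by
    intro r s hrs hst x y
    rw [transMat_mul P hrs hst, Matrix.mul_apply]
  have hosc : ∀ y, ∀ k : ℕ, ∃ s ≤ t, ∃ a, ∀ x,
      transMat P s t x y ∈ Set.Icc a (a + (1 - δ) ^ k) := by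
    intro y k
    induction k with
    | zero =>
      refine ⟨t, le_rfl, 0, fun x => ⟨nonneg_of_mem_rowStochastic (hT _ _), ?_⟩⟩
      simpa using le_one_of_mem_rowStochastic (hT t t)
    | succ k ih =>
      obtain ⟨s, hst, a, ha⟩ := ih
      obtain ⟨r, hr, hPr⟩ := hfreq s
      have ha' : ∀ x, transMat P r t x y ∈ Set.Icc a (a + (1 - δ) ^ k) := by
        intro x
        rw [hpast hr hst]
        exact mulVec_mem_Icc (hT _ _) ha x
      obtain ⟨b, hb⟩ := exists_mulVec_mem_Icc (hP r) hPr ha' x₀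
      refine ⟨r - 1, by omega, b, fun x => ?_⟩
      have h1 : transMat P (r - 1) r = P r := by
        simp [transMat, stepProd]
      rw [hpast (show r - 1 ≤ r by omega) (hr.trans hst), h1, pow_succ']
      exact hb x
  have hev : ∀ y, ∀ ε > 0, ∃ s₀ : ℤ, ∃ a, ∀ s ≤ s₀, ∀ x,
      transMat P s t x y ∈ Set.Icc a (a + ε) := by
    intro y ε hε
    obtain ⟨k, hk⟩ := exists_pow_lt_of_lt_one hε (show 1 - δ < 1 by linarith)
    obtain ⟨s₀, hs₀, a, ha⟩ := hosc y k
    refine ⟨s₀, a, fun s hs x => ?_⟩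
    rw [hpast hs hs₀]
    have := mulVec_mem_Icc (hT s s₀) ha x
    exact ⟨this.1, this.2.trans (by linarith)⟩
  have hlim : ∀ y, ∃ l, Tendsto (fun s => transMat P s t x₀ y) atBot (nhds l) := by
    intro y
    apply cauchy_map_iff_exists_tendsto.1
    rw [Metric.cauchy_iff]
    refine ⟨inferInstance, fun ε hε => ?_⟩
    obtain ⟨s₀, a, ha⟩ := hev y (ε / 2) (half_pos hε)
    refine ⟨Set.Icc a (a + ε / 2), ?_, fun u hu v hv => ?_⟩
    · rw [Filter.mem_map]
      filter_upwards [eventually_le_atBot s₀] with s hs using ha s hs x₀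
    · rw [Real.dist_eq, abs_lt]
      constructor <;> linarith [hu.1, hu.2, hv.1, hv.2]
  choose l hl using hlim
  refine ⟨l, fun x y => ?_⟩
  rw [tendsto_iff_dist_tendsto_zero, Metric.tendsto_nhds]
  intro ε hε
  obtain ⟨s₀, a, ha⟩ := hev y (ε / 2) (half_pos hε)
  filter_upwards [eventually_le_atBot s₀, Metric.tendsto_nhds.1 (hl y) (ε / 2) (half_pos hε)]
    with s hs hs'
  rw [Real.dist_eq, sub_zero, abs_of_nonneg dist_nonneg]
  refine (dist_triangle _ (transMat P s t x₀ y) _).trans_lt ?_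
  have : dist (transMat P s t x y) (transMat P s t x₀ y) ≤ ε / 2 := by
    rw [Real.dist_eq, abs_le]
    constructor <;> linarith [(ha s hs x).1, (ha s hs x).2, (ha s hs x₀).1, (ha s hs x₀).2]
  linarith

lemma isTarget_target {n : ℕ} {P : ℤ → Matrix (Fin n) (Fin n) ℝ} {t : ℤ} (h : TargetExists P t) :
    IsTarget P t (target P t) := by
  rw [target, dif_pos h]
  exact h.choose_spec

/-- The target distribution is a mixture of the rows of `P^{s,t}`, hence inherits all bounds which
hold uniformly over the rows. -/
lemma target_mem_Icc {n : ℕ} {P : ℤ → Matrix (Fin n) (Fin n) ℝ}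
    (hP : ∀ t, P t ∈ rowStochastic ℝ (Fin n)) {s t : ℤ} (hst : s ≤ t) (h : TargetExists P t)
    {y : Fin n} {a b : ℝ} (hab : ∀ x, transMat P s t x y ∈ Set.Icc a b) :
    target P t y ∈ Set.Icc a b := by
  refine isClosed_Icc.mem_of_tendsto (isTarget_target h y y) ?_
  filter_upwards [eventually_le_atBot s] with r hr
  rw [transMat_mul P hr hst, Matrix.mul_apply]
  exact mulVec_mem_Icc (stepProd_mem_rowStochastic hP _ _) hab y

lemma lazyWalk_top_ge {n : ℕ} (hn : 2 ≤ n) (x y : Fin n) :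
    1 / (2 * (n : ℝ)) ≤ lazyWalk (⊤ : SimpleGraph (Fin n)) x y := by
  classical
  have hn' : (2 : ℝ) ≤ n := by exact_mod_cast hn
  have hdeg : nbrSum (⊤ : SimpleGraph (Fin n)) 1 x = n - 1 := by
    have h : nbrSum (⊤ : SimpleGraph (Fin n)) 1 x
        = ∑ z : Fin n, ((1 : ℝ) - if z = x then 1 else 0) := by
      refine Finset.sum_congr rfl fun z _ => ?_
      by_cases hz : z = x <;> simp [hz]
    rw [h, Finset.sum_sub_distrib]
    simp
  rcases eq_or_ne x y with rfl | hxy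
  · rw [lazyWalk_apply_self (by rw [hdeg]; linarith)]
    exact one_div_le_one_div_of_le (by norm_num) (by linarith)
  · rw [lazyWalk_apply_of_ne _ hxy, if_pos (by simpa using hxy), hdeg]
    exact one_div_le_one_div_of_le (by linarith) (by linarith)

/-! ### One step of the walk on a typical graph -/

/-- A graph is typical for the weight vector `w` if the `w`-weight of every neighbourhood and every
degree are of the order of their means for the edge probability `p`, up to an error of `L` times a
uniform bound on the summands. -/
structure Typical {n : ℕ} (p L : ℝ) (w : Fin n → ℝ) (G : SimpleGraph (Fin n)) : Prop where
  le_of_le : ∀ y c, (∀ x, w x ≤ c) → nbrSum G w y ≤ (Real.exp 1 - 1) * p + c * L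
  ge_of_le : ∀ y c, (∀ x, w x ≤ c) →
    (1 - Real.exp (-1)) * p * (1 - w y) - c * L ≤ nbrSum G w y
  deg_le : ∀ y, nbrSum G 1 y ≤ (Real.exp 1 - 1) * p * (n - 1) + L
  le_deg : ∀ y, (1 - Real.exp (-1)) * p * (n - 1) - L ≤ nbrSum G 1 y

lemma vecMul_lazyWalk {n : ℕ} (G : SimpleGraph (Fin n)) (w : Fin n → ℝ) {y : Fin n}
    (hy : 0 < nbrSum G 1 y) :
    (w ᵥ* lazyWalk G) y = w y / 2 + nbrSum G (fun x => w x / (2 * nbrSum G 1 x)) y := by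
  classical
  rw [vecMul, dotProduct, nbrSum, ← Finset.add_sum_erase _ _ (Finset.mem_univ y),
    ← Finset.add_sum_erase (a := y) _ (fun x => if G.Adj x y then _ else _) (Finset.mem_univ y),
    lazyWalk_apply_self hy]
  simp only [SimpleGraph.irrefl, if_false, zero_add]
  congr 1
  · ring
  · refine Finset.sum_congr rfl fun x hx => ?_
    rw [lazyWalk_apply_of_ne G (Finset.ne_of_mem_erase hx)]
    split_ifs <;> ring

lemma nbrSum_mono {n : ℕ} (G : SimpleGraph (Fin n)) {v w : Fin n → ℝ} (h : ∀ x, v x ≤ w x)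
    (y : Fin n) : nbrSum G v y ≤ nbrSum G w y := by
  classical
  refine Finset.sum_le_sum fun x _ => ?_
  split_ifs
  · exact h x
  · exact le_rfl

lemma nbrSum_div {n : ℕ} (G : SimpleGraph (Fin n)) (w : Fin n → ℝ) (c : ℝ) (y : Fin n) :
    nbrSum G (fun x => w x / c) y = nbrSum G w y / c := by
  classical
  simp only [nbrSum, Finset.sum_div, ite_div, zero_div]

lemma exp_one_sub_one_le : Real.exp 1 - 1 ≤ 172 / 100 := by
  linarith [Real.exp_one_lt_d9]

lemma le_one_sub_exp_neg_one : (5 / 8 : ℝ) ≤ 1 - Real.exp (-1) := by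
  have h : (8 / 3 : ℝ) ≤ Real.exp 1 := by linarith [Real.exp_one_gt_d9]
  have : Real.exp (-1) ≤ 3 / 8 := by
    rw [Real.exp_neg]
    calc (Real.exp 1)⁻¹ ≤ (8 / 3 : ℝ)⁻¹ := inv_anti₀ (by norm_num) h
      _ = 3 / 8 := by norm_num
  linarith

section Step

variable {n : ℕ} {η p : ℝ} {w : Fin n → ℝ} {G : SimpleGraph (Fin n)}

lemma Typical.half_le_deg (hη : 50 < η) (hℓ : 0 < Real.log n)
    (hp : p * (n - 1) = η * Real.log n) (hG : Typical p (5 * Real.log n) w G) (y : Fin n) :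
    η * Real.log n / 2 ≤ nbrSum G 1 y := by
  have h := hG.le_deg y
  rw [mul_assoc, hp] at h
  have hpos : 0 < η * Real.log n := by positivity
  have h1 := mul_le_mul_of_nonneg_right le_one_sub_exp_neg_one hpos.le
  have h2 := mul_lt_mul_of_pos_right hη hℓ
  linarith

lemma Typical.deg_le_two_mul (hη : 50 < η) (hℓ : 0 < Real.log n)
    (hp : p * (n - 1) = η * Real.log n) (hG : Typical p (5 * Real.log n) w G) (y : Fin n) :
    nbrSum G 1 y ≤ 2 * (η * Real.log n) := by
  have h := hG.deg_le y
  rw [mul_assoc, hp] at h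
  have hpos : 0 < η * Real.log n := by positivity
  have h1 := mul_le_mul_of_nonneg_right exp_one_sub_one_le hpos.le
  have h2 := mul_lt_mul_of_pos_right hη hℓ
  linarith

/-- On a typical graph one step of the walk is, up to the additive constant `7 / (4 n)`, a
contraction of the maximum of the weights. The inherited half and the fluctuation `5 / η < 1 / 10`
make up the factor `3 / 5`; the mean contributes `(e - 1) / (n - 1)`. -/
lemma Typical.vecMul_lazyWalk_le (hη : 50 < η) (hn : 100 ≤ n)
    (hp : p * (n - 1) = η * Real.log n) (hG : Typical p (5 * Real.log n) w G)
    (hw : ∀ x, 0 ≤ w x) {c : ℝ} (hc : ∀ x, w x ≤ c) (y : Fin n) :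
    (w ᵥ* lazyWalk G) y ≤ 3 / 5 * c + 7 / 4 / n := by
  have hn' : (100 : ℝ) ≤ n := by exact_mod_cast hn
  have hℓ : 0 < Real.log n := Real.log_pos (by linarith)
  have hpos : 0 < η * Real.log n := by positivity
  have hdeg := hG.half_le_deg hη hℓ hp
  have hc0 : 0 ≤ c := (hw y).trans (hc y)
  rw [vecMul_lazyWalk G w (by linarith [hdeg y])]
  have h1 : nbrSum G (fun x => w x / (2 * nbrSum G 1 x)) y
      ≤ ((Real.exp 1 - 1) * p + c * (5 * Real.log n)) / (η * Real.log n) := by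
    refine (nbrSum_mono G (w := fun x => w x / (η * Real.log n)) (fun x => ?_) y).trans ?_
    · exact div_le_div_of_nonneg_left (hw x) hpos (by linarith [hdeg x])
    · rw [nbrSum_div]
      gcongr
      exact hG.le_of_le y c hc
  have h2 : (Real.exp 1 - 1) * p / (η * Real.log n) ≤ 7 / 4 / n := by
    have hp0 : 0 < p := by
      by_contra! h
      nlinarith
    rw [← hp, div_le_div_iff₀ (by nlinarith) (by linarith)]
    have : (Real.exp 1 - 1) * n ≤ 7 / 4 * (n - 1) := by
      nlinarith [exp_one_sub_one_le]
    nlinarith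
  have h3 : c * (5 * Real.log n) / (η * Real.log n) ≤ c / 10 := by
    rw [div_le_div_iff₀ hpos (by norm_num)]
    nlinarith [mul_nonneg hc0 hℓ.le]
  rw [add_div] at h1
  linarith [hc y]

/-- If all weights are at most `5 / n`, the mean `≥ (3 / 5) η log n / n` of the weight of a
neighbourhood dominates its fluctuation `25 log n / n`, and one step of the walk puts mass of order
`1 / n` everywhere. -/
lemma Typical.le_vecMul_lazyWalk (hη : 50 < η) (hn : 125 ≤ n)
    (hp : p * (n - 1) = η * Real.log n) (hG : Typical p (5 * Real.log n) w G)
    (hw : ∀ x, 0 ≤ w x) (hc : ∀ x, w x ≤ 5 / n) (y : Fin n) :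
    1 / 40 / n ≤ (w ᵥ* lazyWalk G) y := by
  have hn' : (125 : ℝ) ≤ n := by exact_mod_cast hn
  have hℓ : 0 < Real.log n := Real.log_pos (by linarith)
  have hpos : 0 < η * Real.log n := by positivity
  have hdeg := hG.half_le_deg hη hℓ hp
  have hdeg' := hG.deg_le_two_mul hη hℓ hp
  rw [vecMul_lazyWalk G w (by linarith [hdeg y])]
  have h1 : nbrSum G w y / (4 * (η * Real.log n))
      ≤ nbrSum G (fun x => w x / (2 * nbrSum G 1 x)) y := by
    rw [← nbrSum_div]
    refine nbrSum_mono G (fun x => ?_) y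
    exact div_le_div_of_nonneg_left (hw x) (by linarith [hdeg x]) (by linarith [hdeg' x])
  have hp1 : η * Real.log n / n ≤ p := by
    have hp0 : 0 < p := by
      by_contra! h
      nlinarith
    rw [div_le_iff₀ (by linarith), ← hp]
    nlinarith
  have h2 : (3 / 5 : ℝ) ≤ (1 - Real.exp (-1)) * (1 - w y) := by
    have h5 : (5 : ℝ) / n ≤ 1 / 25 := by
      rw [div_le_div_iff₀ (by linarith) (by norm_num)]
      linarith
    calc (3 / 5 : ℝ) = 5 / 8 * (24 / 25) := by norm_num
      _ ≤ _ := mul_le_mul le_one_sub_exp_neg_one (by linarith [hc y]) (by norm_num)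
          (by linarith [le_one_sub_exp_neg_one])
  have h3 : 1 / 10 * (η * Real.log n / n) ≤ nbrSum G w y := by
    have h4 := hG.ge_of_le y _ hc
    have h5 : 3 / 5 * (η * Real.log n / n) ≤ (1 - Real.exp (-1)) * p * (1 - w y) := by
      calc _ ≤ ((1 - Real.exp (-1)) * (1 - w y)) * p :=
            mul_le_mul h2 hp1 (by positivity) (by linarith)
        _ = _ := by ring
    have h6 : (5 : ℝ) / n * (5 * Real.log n) ≤ 1 / 2 * (η * Real.log n / n) := by
      have : (5 : ℝ) / n * (5 * Real.log n) = 25 * Real.log n / n := by ring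
      rw [this, ← mul_div_assoc]
      exact div_le_div_of_nonneg_right (by nlinarith) (by positivity)
    linarith
  have h7 : 1 / 40 / (n : ℝ) = 1 / 10 * (η * Real.log n / n) / (4 * (η * Real.log n)) := by
    field_simp
    norm_num
  have h8 : 1 / 40 / (n : ℝ) ≤ nbrSum G w y / (4 * (η * Real.log n)) := by
    rw [h7]
    gcongr
  linarith [hw y]

end Step

/-! ### The rows of the transition matrices along typical graphs -/

section Rows

variable {n : ℕ} {η p : ℝ} {g : ℤ → SimpleGraph (Fin n)} {s : ℤ} {x₀ : Fin n} {K : ℕ}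

lemma stepProd_row_succ (P : ℤ → Matrix (Fin n) (Fin n) ℝ) (s : ℤ) (k : ℕ) (x : Fin n) :
    stepProd P s (k + 1) x = stepProd P s k x ᵥ* P (s + k + 1) := by
  ext y
  rw [stepProd, Matrix.mul_apply, vecMul, dotProduct]

/-- The maximum of a row obeys `M ↦ (3 / 5) M + 7 / (4 n)`, whose fixed point is `35 / (8 n)`. -/
lemma stepProd_row_le (hη : 50 < η) (hn : 100 ≤ n) (hp : p * (n - 1) = η * Real.log n)
    (hg : ∀ j < K, Typical p (5 * Real.log n)
      (stepProd (fun t => lazyWalk (g t)) s j x₀) (g (s + j + 1)))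
    (j : ℕ) (hj : j ≤ K) (y : Fin n) :
    stepProd (fun t => lazyWalk (g t)) s j x₀ y ≤ (3 / 5) ^ j + 35 / 8 / n := by
  have hst := stepProd_mem_rowStochastic (fun t => lazyWalk_mem_rowStochastic (g t)) s
  induction j generalizing y with
  | zero =>
    have := le_one_of_mem_rowStochastic (hst 0) (i := x₀) (j := y)
    have h0 : (0 : ℝ) ≤ 35 / 8 / n := by positivity
    simpa using this.trans (by linarith)
  | succ j ih =>
    rw [stepProd_row_succ]
    refine ((hg j (by omega)).vecMul_lazyWalk_le hη hn hp
      (fun x => nonneg_of_mem_rowStochastic (hst j)) (fun x => ih (by omega) x) y).trans ?_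
    rw [pow_succ]
    apply le_of_eq
    ring

lemma stepProd_row_mem_Icc (hη : 50 < η) (hn : 125 ≤ n) (hp : p * (n - 1) = η * Real.log n)
    (hpow : (3 / 5 : ℝ) ^ n ≤ 5 / 8 / n)
    (hg : ∀ j < K, Typical p (5 * Real.log n)
      (stepProd (fun t => lazyWalk (g t)) s j x₀) (g (s + j + 1)))
    (j : ℕ) (hnj : n < j) (hj : j ≤ K) (y : Fin n) :
    stepProd (fun t => lazyWalk (g t)) s j x₀ y ∈ Set.Icc (1 / 40 / (n : ℝ)) (5 / n) := by
  have hst := stepProd_mem_rowStochastic (fun t => lazyWalk_mem_rowStochastic (g t)) s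
  have hup : ∀ i, n ≤ i → i ≤ K → ∀ y,
      stepProd (fun t => lazyWalk (g t)) s i x₀ y ≤ 5 / n := by
    intro i hi hiK y
    refine (stepProd_row_le hη (by omega) hp hg i hiK y).trans ?_
    have h1 : (3 / 5 : ℝ) ^ i ≤ (3 / 5) ^ n :=
      pow_le_pow_of_le_one (by norm_num) (by norm_num) hi
    calc _ ≤ 5 / 8 / (n : ℝ) + 35 / 8 / n := by linarith
      _ = 5 / n := by ring
  refine ⟨?_, hup j hnj.le hj y⟩
  obtain ⟨i, rfl⟩ : ∃ i, j = i + 1 := ⟨j - 1, by omega⟩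
  rw [stepProd_row_succ]
  exact (hg i (by omega)).le_vecMul_lazyWalk hη hn hp
    (fun x => nonneg_of_mem_rowStochastic (hst i)) (hup i (by omega) (by omega)) y

end Rows

/-! ### Chernoff bounds for weighted neighbourhoods in a binomial random graph -/

section Chernoff

variable {n : ℕ} (p : unitInterval)

/-- The law of a single potential edge, as a random proposition. -/
noncomputable abbrev edgeLaw (p : unitInterval) (e : Sym2 (Fin n)) : Measure Prop :=
  unitInterval.toNNReal p • Measure.dirac (e ∈ (Sym2.diagSetᶜ : Set (Sym2 (Fin n))))
    + unitInterval.toNNReal (unitInterval.symm p) • Measure.dirac False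

lemma integral_edgeLaw {e : Sym2 (Fin n)} (he : ¬ e.IsDiag) (f : Prop → ℝ) :
    ∫ b, f b ∂(edgeLaw p e) = p * f True + (1 - p) * f False := by
  have h : (e ∈ (Sym2.diagSetᶜ : Set (Sym2 (Fin n)))) = True := by simpa using he
  rw [integral_add_measure, integral_smul_nnreal_measure, integral_smul_nnreal_measure, h,
    integral_dirac, integral_dirac]
  · simp [NNReal.smul_def]
  · exact (integrable_dirac (by finiteness)).smul_measure_nnreal
  · exact (integrable_dirac (by finiteness)).smul_measure_nnreal

lemma binomialRandom_eq_map_infinitePi :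
    SimpleGraph.binomialRandom (Fin n) p
      = (Measure.infinitePi (edgeLaw (n := n) p)).map
        (fun b => SimpleGraph.fromEdgeSet {e | b e}) := by
  rw [SimpleGraph.binomialRandom_eq_map, setBernoulli_eq_map, Measure.map_map]
  · rfl
  · exact SimpleGraph.measurable_fromEdgeSet
  · exact MeasurableEquiv.setOfPred.measurable

instance : DiscreteMeasurableSpace (SimpleGraph (Fin n)) := by
  have : MeasurableSingletonClass (SimpleGraph (Fin n)) := ⟨fun G => by
    have h : ({G} : Set (SimpleGraph (Fin n))) = SimpleGraph.edgeSet ⁻¹' {G.edgeSet} := by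
      ext H
      simp
    rw [h]
    exact SimpleGraph.measurable_edgeSet (MeasurableSet.singleton _)⟩
  infer_instance

open Classical in
/-- The moment generating function of the weight of a neighbourhood, bounded through the convexity
estimate `exp (t v) ≤ 1 + (exp t - 1) v` for `v ∈ [0, 1]`. -/
lemma mgf_nbrSum_le {v : Fin n → ℝ} (hv : ∀ x, v x ∈ Set.Icc (0 : ℝ) 1) (y : Fin n) (t : ℝ) :
    mgf (fun G => nbrSum G v y) (SimpleGraph.binomialRandom (Fin n) p) t
      ≤ Real.exp ((Real.exp t - 1) * p * ∑ x ∈ Finset.univ.erase y, v x) := by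
  set X : Fin n → (Sym2 (Fin n) → Prop) → ℝ := fun x b => if b s(x, y) then v x else 0 with hX
  have hmap : mgf (fun G => nbrSum G v y) (SimpleGraph.binomialRandom (Fin n) p) t
      = mgf (∑ x ∈ Finset.univ.erase y, X x) (Measure.infinitePi (edgeLaw (n := n) p)) t := by
    rw [binomialRandom_eq_map_infinitePi, mgf_map]
    · congr 1
      ext b
      simp only [Function.comp, nbrSum, Finset.sum_apply, hX, SimpleGraph.fromEdgeSet_adj]
      rw [← Finset.add_sum_erase _ _ (Finset.mem_univ y)]
      simp only [ne_eq, not_true, and_false, if_false, zero_add]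
      refine Finset.sum_congr rfl fun x hx => ?_
      simp [Finset.ne_of_mem_erase hx]
    · exact (SimpleGraph.measurable_fromEdgeSet.comp
        MeasurableEquiv.setOfPred.measurable).aemeasurable
    · exact (Measurable.of_discrete).aestronglyMeasurable
  have hmeas : ∀ x, Measurable (fun b : Prop => if b then v x else 0) := fun x =>
    Measurable.of_discrete
  have hXm : ∀ x, Measurable (X x) := fun x => (hmeas x).comp (measurable_pi_apply _)
  have hinj : Function.Injective (fun x : Fin n => s(x, y)) := fun a b h => by
    have h' : a = b ∨ a = y ∧ y = b := by simpa using h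
    rcases h' with h' | ⟨h1, h2⟩
    exacts [h', h1.trans h2]
  have hind : iIndepFun X (Measure.infinitePi (edgeLaw (n := n) p)) := by
    have h := (iIndepFun_infinitePi (P := edgeLaw (n := n) p)
      (X := fun _ (b : Prop) => b) (fun _ => measurable_id)).precomp hinj
    exact h.comp (fun x b => if b then v x else 0) hmeas
  rw [hmap, hind.mgf_sum hXm, Finset.mul_sum, Real.exp_sum]
  refine Finset.prod_le_prod (fun _ _ => mgf_nonneg) fun x hx => ?_
  have hne : ¬ (s(x, y)).IsDiag := by simpa using Finset.ne_of_mem_erase hx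
  have h1 : mgf (X x) (Measure.infinitePi (edgeLaw (n := n) p)) t
      = p * Real.exp (t * v x) + (1 - p) := by
    have h2 : mgf (X x) (Measure.infinitePi (edgeLaw (n := n) p)) t
        = mgf (fun b : Prop => if b then v x else 0) (edgeLaw p s(x, y)) t := by
      rw [← Measure.infinitePi_map_eval (edgeLaw (n := n) p) s(x, y), mgf_map]
      · rfl
      · exact (measurable_pi_apply _).aemeasurable
      · exact (Measurable.of_discrete).aestronglyMeasurable
    rw [h2, mgf, integral_edgeLaw p hne]
    simp
  have h3 : Real.exp (t * v x) ≤ 1 + (Real.exp t - 1) * v x := by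
    have h := convexOn_exp.2 (Set.mem_univ t) (Set.mem_univ 0) (hv x).1
      (sub_nonneg.2 (hv x).2) (by ring)
    simp only [smul_eq_mul, mul_zero, add_zero, Real.exp_zero, mul_one] at h
    rw [mul_comm t]
    linarith
  rw [h1]
  calc (p : ℝ) * Real.exp (t * v x) + (1 - p)
      ≤ p * (1 + (Real.exp t - 1) * v x) + (1 - p) := by
        gcongr
        exact p.2.1
    _ = (Real.exp t - 1) * p * v x + 1 := by ring
    _ ≤ _ := Real.add_one_le_exp _

lemma measureReal_nbrSum_ge {v : Fin n → ℝ} (hv : ∀ x, v x ∈ Set.Icc (0 : ℝ) 1) (y : Fin n)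
    (L : ℝ) :
    (SimpleGraph.binomialRandom (Fin n) p).real
      {G | (Real.exp 1 - 1) * p * ∑ x ∈ Finset.univ.erase y, v x + L ≤ nbrSum G v y}
      ≤ Real.exp (-L) := by
  refine (measure_ge_le_exp_mul_mgf _ zero_le_one Integrable.of_finite).trans ?_
  refine (mul_le_mul_of_nonneg_left (mgf_nbrSum_le p hv y 1) (Real.exp_pos _).le).trans ?_
  rw [← Real.exp_add]
  apply le_of_eq
  congr 1
  ring

lemma measureReal_nbrSum_le {v : Fin n → ℝ} (hv : ∀ x, v x ∈ Set.Icc (0 : ℝ) 1) (y : Fin n)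
    (L : ℝ) :
    (SimpleGraph.binomialRandom (Fin n) p).real
      {G | nbrSum G v y ≤ (1 - Real.exp (-1)) * p * ∑ x ∈ Finset.univ.erase y, v x - L}
      ≤ Real.exp (-L) := by
  refine (measure_le_le_exp_mul_mgf _ (by norm_num : (-1 : ℝ) ≤ 0) Integrable.of_finite).trans ?_
  refine (mul_le_mul_of_nonneg_left (mgf_nbrSum_le p hv y (-1)) (Real.exp_pos _).le).trans ?_
  rw [← Real.exp_add]
  apply le_of_eq
  congr 1
  ring

/-- A binomial random graph is typical for a fixed probability vector, up to probability
`4 n exp (-L)`. The weights are divided by their maximum before the Chernoff bounds apply. -/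
lemma measureReal_not_typical_le (hn : 0 < n) {L : ℝ} (hL : 0 ≤ L) {w : Fin n → ℝ}
    (hw : ∀ x, 0 ≤ w x) (hw1 : ∑ x, w x = 1) :
    (SimpleGraph.binomialRandom (Fin n) p).real {G | ¬ Typical p L w G}
      ≤ 4 * n * Real.exp (-L) := by
  have : Nonempty (Fin n) := ⟨⟨0, hn⟩⟩
  obtain ⟨x₁, hx₁⟩ := Finite.exists_max w
  have hpos : 0 < w x₁ := by
    by_contra! h
    have : ∑ x, w x ≤ 0 := Finset.sum_nonpos fun x _ => (hx₁ x).trans h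
    linarith
  have hv : ∀ x, w x / w x₁ ∈ Set.Icc (0 : ℝ) 1 := fun x =>
    ⟨div_nonneg (hw x) hpos.le, (div_le_one hpos).2 (hx₁ x)⟩
  have hone : ∀ x : Fin n, (1 : Fin n → ℝ) x ∈ Set.Icc (0 : ℝ) 1 := fun x => by simp
  have hsum : ∀ y, ∑ x ∈ Finset.univ.erase y, w x / w x₁ = (1 - w y) / w x₁ := by
    intro y
    rw [← Finset.sum_div, ← hw1, ← Finset.add_sum_erase _ _ (Finset.mem_univ y)]
    ring
  have hsum1 : ∀ y : Fin n, ∑ x ∈ Finset.univ.erase y, (1 : Fin n → ℝ) x = n - 1 := by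
    intro y
    simp [Finset.card_erase_of_mem, Nat.cast_sub hn]
  set B : Fin n → Set (SimpleGraph (Fin n)) := fun y =>
    (({G | (Real.exp 1 - 1) * p * ∑ x ∈ Finset.univ.erase y, w x / w x₁ + L
          ≤ nbrSum G (fun x => w x / w x₁) y} ∪
      {G | nbrSum G (fun x => w x / w x₁) y
          ≤ (1 - Real.exp (-1)) * p * ∑ x ∈ Finset.univ.erase y, w x / w x₁ - L}) ∪
      {G | (Real.exp 1 - 1) * p * ∑ x ∈ Finset.univ.erase y, (1 : Fin n → ℝ) x + L
          ≤ nbrSum G 1 y}) ∪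
      {G | nbrSum G 1 y
          ≤ (1 - Real.exp (-1)) * p * ∑ x ∈ Finset.univ.erase y, (1 : Fin n → ℝ) x - L} with hB
  have hBle : ∀ y, (SimpleGraph.binomialRandom (Fin n) p).real (B y) ≤ 4 * Real.exp (-L) := by
    intro y
    have h1 := measureReal_nbrSum_ge p hv y L
    have h2 := measureReal_nbrSum_le p hv y L
    have h3 := measureReal_nbrSum_ge p hone y L
    have h4 := measureReal_nbrSum_le p hone y L
    refine (measureReal_union_le _ _).trans ?_
    refine (add_le_add_left ((measureReal_union_le _ _).trans
      (add_le_add_left (measureReal_union_le _ _) _)) _).trans ?_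
    linarith
  have hsub : {G | ¬ Typical p L w G} ⊆ ⋃ y, B y := by
    intro G hG
    by_contra hGB
    apply hG
    simp only [hB, Set.mem_iUnion, Set.mem_union, Set.mem_ofPred_eq, not_exists, not_or, not_le,
      nbrSum_div, hsum, hsum1] at hGB
    have he1 : 0 ≤ Real.exp 1 - 1 := by linarith [Real.add_one_le_exp (1 : ℝ)]
    refine ⟨fun y c hc => ?_, fun y c hc => ?_, fun y => (hGB y).1.2.le, fun y => (hGB y).2.le⟩
    · have h := (hGB y).1.1.1
      rw [← mul_div_assoc, div_lt_iff₀ hpos, add_mul, div_mul_cancel₀ _ hpos.ne'] at h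
      have h5 : (Real.exp 1 - 1) * p * (1 - w y) ≤ (Real.exp 1 - 1) * p :=
        mul_le_of_le_one_right (mul_nonneg he1 p.2.1) (by linarith [hw y])
      have h6 := mul_le_mul_of_nonneg_right (hc x₁) hL
      linarith
    · have h := (hGB y).1.1.2
      rw [← mul_div_assoc, lt_div_iff₀ hpos, sub_mul, div_mul_cancel₀ _ hpos.ne'] at h
      have h6 := mul_le_mul_of_nonneg_right (hc x₁) hL
      linarith
  calc _ ≤ (SimpleGraph.binomialRandom (Fin n) p).real (⋃ y, B y) := measureReal_mono hsub
    _ ≤ ∑ y, (SimpleGraph.binomialRandom (Fin n) p).real (B y) := measureReal_iUnion_fintype_le _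
    _ ≤ ∑ _y : Fin n, 4 * Real.exp (-L) := Finset.sum_le_sum fun y _ => hBle y
    _ = _ := by
      simp
      ring

end Chernoff

/-! ### The walk on the dynamic graph -/

/-- A bound on the probability of the sections of a set, uniform over the first coordinate, carries
over to an independent pair. -/
lemma measureReal_pair_mem_le {Ω 𝓧 𝓨 : Type*} [MeasurableSpace Ω] [MeasurableSpace 𝓧]
    [MeasurableSpace 𝓨] {μ : Measure Ω} [IsProbabilityMeasure μ] {X : Ω → 𝓧} {Y : Ω → 𝓨}
    (hX : Measurable X) (hY : Measurable Y) (hXY : IndepFun X Y μ) {B : Set (𝓧 × 𝓨)}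
    (hB : MeasurableSet B) {c : ℝ} (hc : 0 ≤ c)
    (hsec : ∀ x, (μ.map Y).real (Prod.mk x ⁻¹' B) ≤ c) :
    μ.real {ω | (X ω, Y ω) ∈ B} ≤ c := by
  have := Measure.isProbabilityMeasure_map hX.aemeasurable (μ := μ)
  have := Measure.isProbabilityMeasure_map hY.aemeasurable (μ := μ)
  have h1 : μ {ω | (X ω, Y ω) ∈ B} = ((μ.map X).prod (μ.map Y)) B := by
    rw [← (indepFun_iff_map_prod_eq_prod_map_map hX.aemeasurable hY.aemeasurable).1 hXY,
      Measure.map_apply (hX.prodMk hY) hB]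
    rfl
  refine ENNReal.toReal_le_of_le_ofReal hc ?_
  rw [h1, Measure.prod_apply hB]
  calc _ ≤ ∫⁻ _, ENNReal.ofReal c ∂(μ.map X) := by
        refine lintegral_mono fun x => ?_
        rw [← ofReal_measureReal]
        exact ENNReal.ofReal_le_ofReal (hsec x)
    _ = _ := by simp

lemma walkSeq_mem_rowStochastic {Ω : Type*} {n : ℕ} (G : ℤ → Ω → SimpleGraph (Fin n)) (ω : Ω)
    (t : ℤ) : walkSeq G ω t ∈ rowStochastic ℝ (Fin n) := lazyWalk_mem_rowStochastic _

section Walk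

variable {Ω : Type*} [MeasurableSpace Ω] {μ : Measure Ω} [IsProbabilityMeasure μ] {n : ℕ}
  {p : unitInterval} {G : ℤ → Ω → SimpleGraph (Fin n)}

/-- A row of `P^{s,s+j}` depends on `G_{s+1}, …, G_{s+j}` only, so `G_{s+j+1}` is typical for it
with the same probability as for a fixed weight vector. -/
lemma IsDynamicErdosRenyi.measureReal_not_typical_row_le (h : IsDynamicErdosRenyi μ p G)
    {L : ℝ} (hL : 0 ≤ L) (s : ℤ) (j : ℕ) (x₀ : Fin n) :
    μ.real {ω | ¬ Typical p L (stepProd (walkSeq G ω) s j x₀) (G (s + j + 1) ω)}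
      ≤ 4 * n * Real.exp (-L) := by
  classical
  have hn : 0 < n := x₀.pos
  set S := Finset.Ioc s (s + j) with hS
  set t := s + j + 1 with ht
  let past : (S → SimpleGraph (Fin n)) → ℤ → Matrix (Fin n) (Fin n) ℝ := fun H i =>
    lazyWalk (if hi : i ∈ S then H ⟨i, hi⟩ else ⊥)
  have hpast : ∀ ω, stepProd (walkSeq G ω) s j
      = stepProd (past fun i => G i ω) s j := by
    intro ω
    refine stepProd_congr fun i hi => ?_
    simp only [walkSeq, past]
    rw [dif_pos hi]
  have hdisj : Disjoint S {t} := by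
    simp only [Finset.disjoint_singleton_right, hS, Finset.mem_Ioc, ht]
    omega
  have hind : IndepFun (fun ω (i : S) => G i ω) (G t) μ :=
    (h.indep.indepFun_finset S {t} hdisj h.measurable).comp (φ := id)
      (ψ := fun H : ({t} : Finset ℤ) → SimpleGraph (Fin n) =>
        H ⟨t, Finset.mem_singleton_self t⟩) measurable_id (measurable_pi_apply _)
  simp_rw [hpast]
  refine measureReal_pair_mem_le (X := fun ω (i : S) => G i ω) (Y := G t)
    (B := {q | ¬ Typical p L (stepProd (past q.1) s j x₀) q.2})
    (measurable_pi_iff.2 fun i => h.measurable i) (h.measurable t) hind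
    (Set.Finite.measurableSet (Set.toFinite _)) (by positivity) fun H => ?_
  have hst := stepProd_mem_rowStochastic (P := past H) (fun i => lazyWalk_mem_rowStochastic _) s j
  rw [(h.hasLaw t).map_eq]
  exact measureReal_not_typical_le p hn hL (fun x => nonneg_of_mem_rowStochastic hst)
    (sum_row_of_mem_rowStochastic hst x₀)

/-- By the second Borel–Cantelli lemma the complete graph almost surely occurs infinitely often in
the past, since it has positive probability. -/
lemma IsDynamicErdosRenyi.ae_frequently_top (h : IsDynamicErdosRenyi μ p G) (hp : 0 < (p : ℝ)) :
    ∀ᵐ ω ∂μ, ∀ t : ℤ, ∃ s ≤ t, G s ω = ⊤ := by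
  classical
  set A : ℕ → Set Ω := fun k => G (-k) ⁻¹' {⊤} with hA
  have hAm : ∀ k, MeasurableSet (A k) := fun k => h.measurable _ (MeasurableSet.singleton _)
  have hind : iIndepSet A μ := by
    rw [iIndepSet_iff_meas_biInter hAm]
    intro S
    refine (h.indep.precomp (g := fun k : ℕ => -(k : ℤ))
      (fun a b hab => by simpa using hab)).meas_biInter fun k _ => ?_
    exact ⟨{⊤}, MeasurableSet.singleton _, rfl⟩
  have hprob : ∀ k, μ (A k) = SimpleGraph.binomialRandom (Fin n) p {⊤} := by
    intro k
    rw [hA, ← Measure.map_apply (h.measurable _) (MeasurableSet.singleton _),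
      (h.hasLaw _).map_eq]
  have hpos : SimpleGraph.binomialRandom (Fin n) p {⊤} ≠ 0 := by
    have hcard : (⊤ : SimpleGraph (Fin n)).edgeSet.ncard = (Nat.card (Fin n)).choose 2 := by
      rw [Set.ncard_eq_toFinset_card', Nat.card_eq_fintype_card,
        ← SimpleGraph.card_edgeFinset_top_eq_card_choose_two]
      congr
    have hp' : unitInterval.toNNReal p ≠ 0 := by
      intro h0
      have : ((unitInterval.toNNReal p : NNReal) : ℝ) = 0 := by rw [h0]; rfl
      rw [unitInterval.coe_toNNReal] at this
      exact hp.ne' this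
    rw [SimpleGraph.binomialRandom_singleton, hcard, Nat.sub_self, pow_zero, mul_one]
    exact pow_ne_zero _ (by exact_mod_cast hp')
  have hsum : ∑' k, μ (A k) = ⊤ := by
    simp_rw [hprob]
    exact ENNReal.tsum_const_eq_top_of_ne_zero hpos
  have hlim := measure_limsup_eq_one hAm hind hsum
  have hae : ∀ᵐ ω ∂μ, ω ∈ limsup A atTop := by
    exact (mem_ae_iff_prob_eq_one (MeasurableSet.measurableSet_limsup hAm)).2 hlim
  filter_upwards [hae] with ω hω t
  rw [mem_limsup_iff_frequently_mem] at hω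
  obtain ⟨k, hk, hkA⟩ := (frequently_atTop.1 hω) (-t).toNat
  exact ⟨-k, by omega, hkA⟩

lemma IsDynamicErdosRenyi.ae_targetExists (h : IsDynamicErdosRenyi μ p G) (hp : 0 < (p : ℝ))
    (hn : 2 ≤ n) : ∀ᵐ ω ∂μ, ∀ t : ℤ, TargetExists (walkSeq G ω) t := by
  filter_upwards [h.ae_frequently_top hp] with ω hω t
  have hn' : (0 : ℝ) < n := by exact_mod_cast (by omega : 0 < n)
  refine targetExists_of_frequently (walkSeq_mem_rowStochastic G ω)
    (δ := 1 / (2 * (n : ℝ))) (by positivity) (fun r => ?_) t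
  obtain ⟨s, hs, hG⟩ := hω r
  refine ⟨s, hs, fun x y => ?_⟩
  rw [walkSeq, hG]
  exact lazyWalk_top_ge hn x y

/-- All `n ^ 2 + n + 1` steps of the walks started at time `-(n + 1)` meet typical graphs with
probability at least `1 - 8 / n`; the first `n + 1` steps let the walks forget their start. -/
lemma IsDynamicErdosRenyi.measureReal_target_ge (h : IsDynamicErdosRenyi μ p G) {η : ℝ}
    (hη : 50 < η) (hn : 125 ≤ n) (hp : (p : ℝ) * (n - 1) = η * Real.log n)
    (hpow : (3 / 5 : ℝ) ^ n ≤ 5 / 8 / n) :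
    1 - 8 / (n : ℝ) ≤ μ.real {ω | ∀ t : ℕ, t ≤ n ^ 2 → ∀ x : Fin n,
      target (walkSeq G ω) t x ∈ Set.Icc (1 / 40 / (n : ℝ)) (5 / n)} := by
  have hn' : (125 : ℝ) ≤ n := by exact_mod_cast hn
  have hℓ : 0 < Real.log n := Real.log_pos (by linarith)
  have hp0 : 0 < (p : ℝ) := by
    by_contra! h0
    nlinarith [mul_pos (show 0 < η by linarith) hℓ]
  set s : ℤ := -(n + 1) with hs
  set K := n ^ 2 + n + 1 with hK
  set B : Fin K → Fin n → Set Ω := fun j x₀ =>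
    {ω | ¬ Typical p (5 * Real.log n) (stepProd (walkSeq G ω) s j x₀) (G (s + j + 1) ω)} with hB
  set N : Set Ω := {ω | ¬ ∀ t : ℤ, TargetExists (walkSeq G ω) t} with hN
  set A : Set Ω := {ω | ∀ t : ℕ, t ≤ n ^ 2 → ∀ x : Fin n,
      target (walkSeq G ω) t x ∈ Set.Icc (1 / 40 / (n : ℝ)) (5 / n)} with hA
  -- Subadditivity of the outer measure makes the measurability of `A` irrelevant.
  have hcover : (Set.univ : Set Ω) ⊆ A ∪ (N ∪ ⋃ j, ⋃ x₀, B j x₀) := by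
    intro ω _
    by_contra hω
    simp only [Set.mem_union, not_or] at hω
    obtain ⟨hωA, hωN, hωB⟩ := hω
    apply hωA
    intro t ht y
    simp only [hN, Set.mem_ofPred_eq, not_not] at hωN
    refine target_mem_Icc (walkSeq_mem_rowStochastic G ω) (s := s) (by omega) (hωN t) fun x₀ => ?_
    have hj : ((t : ℤ) - s).toNat = t + n + 1 := by omega
    rw [transMat, hj]
    refine stepProd_row_mem_Icc (K := K) hη hn hp hpow (fun j hjK => ?_) _ (by omega) (by omega) y
    simp only [hB, Set.mem_iUnion, Set.mem_ofPred_eq, not_exists, not_not] at hωB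
    exact hωB ⟨j, hjK⟩ x₀
  have hNz : μ.real N = 0 := by
    have := h.ae_targetExists hp0 (by omega)
    rw [ae_iff] at this
    rw [hN, Measure.real, this, ENNReal.toReal_zero]
  have hBle : ∀ j x₀, μ.real (B j x₀) ≤ 4 * n * Real.exp (-(5 * Real.log n)) := fun j x₀ =>
    h.measureReal_not_typical_row_le (by positivity) s j x₀
  have hexp : Real.exp (-(5 * Real.log n)) = 1 / (n : ℝ) ^ 5 := by
    rw [Real.exp_neg, mul_comm, Real.exp_mul, Real.exp_log (by linarith), one_div]
    norm_cast
  have hunion : μ.real (⋃ j, ⋃ x₀, B j x₀) ≤ 8 / n := by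
    calc _ ≤ ∑ j, μ.real (⋃ x₀, B j x₀) := measureReal_iUnion_fintype_le _
      _ ≤ ∑ j, ∑ x₀, μ.real (B j x₀) :=
          Finset.sum_le_sum fun j _ => measureReal_iUnion_fintype_le _
      _ ≤ ∑ _j : Fin K, ∑ _x₀ : Fin n, 4 * n * Real.exp (-(5 * Real.log n)) :=
          Finset.sum_le_sum fun j _ => Finset.sum_le_sum fun x₀ _ => hBle j x₀
      _ = K * (4 * (n : ℝ) ^ 2 / (n : ℝ) ^ 5) := by
          rw [hexp]
          simp
          ring
      _ ≤ (2 * (n : ℝ) ^ 2) * (4 * (n : ℝ) ^ 2 / (n : ℝ) ^ 5) := by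
          gcongr
          rw [hK]
          push_cast
          nlinarith
      _ = 8 / n := by
          field_simp
          norm_num
  have htot : (1 : ℝ) ≤ μ.real A + (μ.real N + μ.real (⋃ j, ⋃ x₀, B j x₀)) := by
    calc (1 : ℝ) = μ.real Set.univ := by simp
      _ ≤ μ.real (A ∪ (N ∪ ⋃ j, ⋃ x₀, B j x₀)) := measureReal_mono hcover
      _ ≤ _ := (measureReal_union_le _ _).trans (by gcongr; exact measureReal_union_le _ _)
  linarith

end Walk

end DynER

theorem mainTheorem4 (η : ℝ) (hη : 50 < η) :
    ∃ α₁ α₂ β : ℝ, 0 < α₁ ∧ α₁ < 1 ∧ 1 < α₂ ∧ 0 < β ∧ ∃ N : ℕ, ∀ n : ℕ, N ≤ n →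
      ∃ a₁ a₂ : ℕ → ℝ,
        MonotoneOn a₁ (Set.Icc 0 (n ^ 2)) ∧ AntitoneOn a₂ (Set.Icc 0 (n ^ 2)) ∧
        (∀ t : ℕ, n ^ 2 - n ≤ t → t ≤ n ^ 2 → a₁ t = α₁ ∧ a₂ t = α₂) ∧
        ∀ (Ω : Type*) [MeasurableSpace Ω] (μ : MeasureTheory.Measure Ω)
          [MeasureTheory.IsProbabilityMeasure μ] (p : unitInterval)
          (G : ℤ → Ω → SimpleGraph (Fin n)),
          (p : ℝ) = η * Real.log n / ((n : ℝ) - 1) → DynER.IsDynamicErdosRenyi μ p G →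
          (∀ᵐ ω ∂μ, ∀ t : ℤ, DynER.TargetExists (DynER.walkSeq G ω) t) ∧
          1 - (n : ℝ) ^ (-β) ≤ μ.real {ω | ∀ t : ℕ, t ≤ n ^ 2 → ∀ x : Fin n,
            a₁ t / n ≤ DynER.target (DynER.walkSeq G ω) t x ∧
              DynER.target (DynER.walkSeq G ω) t x ≤ a₂ t / n} ∧
          1 - (n : ℝ) ^ (-β) ≤ μ.real {ω | ∀ t : ℕ, t ≤ n → ∀ x : Fin n,
            α₁ / n ≤ DynER.target (DynER.walkSeq G ω) t x ∧
              DynER.target (DynER.walkSeq G ω) t x ≤ α₂ / n} := by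
  obtain ⟨N, hN⟩ : ∃ N : ℕ, ∀ n : ℕ, N ≤ n → (3 / 5 : ℝ) ^ n ≤ 5 / 8 / n := by
    have h := tendsto_self_mul_const_pow_of_lt_one (r := (3 / 5 : ℝ)) (by norm_num) (by norm_num)
    obtain ⟨N, hN⟩ := Filter.eventually_atTop.1
      ((h.eventually_le_const (show (0 : ℝ) < 5 / 8 by norm_num)).and
        (Filter.eventually_gt_atTop 0))
    refine ⟨N, fun n hn => ?_⟩
    obtain ⟨h1, h2⟩ := hN n hn
    rw [le_div_iff₀ (by exact_mod_cast h2), mul_comm]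
    exact h1
  refine ⟨1 / 40, 5, 1 / 2, by norm_num, by norm_num, by norm_num, by norm_num, max N 125,
    fun n hn => ⟨fun _ => 1 / 40, fun _ => 5, monotoneOn_const, antitoneOn_const,
      fun _ _ _ => ⟨rfl, rfl⟩, ?_⟩⟩
  intro Ω _ μ _ p G hp hG
  have hn125 : 125 ≤ n := (le_max_right _ _).trans hn
  have hn' : (125 : ℝ) ≤ n := by exact_mod_cast hn125
  have hpn : (p : ℝ) * (n - 1) = η * Real.log n := by
    rw [hp, div_mul_cancel₀]
    linarith
  have hp0 : 0 < (p : ℝ) := by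
    rw [hp]
    exact div_pos (mul_pos (by linarith) (Real.log_pos (by linarith))) (by linarith)
  have hmain := hG.measureReal_target_ge hη hn125 hpn (hN n ((le_max_left _ _).trans hn))
  have hβ : 8 / (n : ℝ) ≤ (n : ℝ) ^ (-(1 / 2) : ℝ) := by
    have h8 : (8 : ℝ) ≤ √n := Real.le_sqrt_of_sq_le (by linarith)
    have hsq : √(n : ℝ) * √n = n := Real.mul_self_sqrt (by linarith)
    rw [Real.rpow_neg (by linarith), ← Real.sqrt_eq_rpow, div_le_iff₀ (by linarith)]
    calc (8 : ℝ) ≤ √n := h8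
      _ = (√n)⁻¹ * n := by
        nth_rewrite 3 [← hsq]
        field_simp
  refine ⟨hG.ae_targetExists hp0 (by omega), (by linarith : _ ≤ _).trans hmain,
    (by linarith : _ ≤ _).trans (hmain.trans (MeasureTheory.measureReal_mono fun ω hω t ht => ?_))⟩
  exact hω t (ht.trans (Nat.le_self_pow two_ne_zero n))
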